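/- Let $\mathbb{N}=\{1,2,3,\dots\}$ be discrete and give $\mathbb{N}^{\mathbb{N}\times\mathbb{N}}$ the product topology. Let $\mathcal{G}\subseteq\mathbb{N}^{\mathbb{N}\times\mathbb{N}}$ be the subspace of those tables $G$ that are the multiplication table of a group $\widetilde G$ with underlying set $\mathbb{N}$ and identity element $1$, and let $\mathcal{A}=\{G\in\mathcal{G}:\widetilde G\text{ is abelian}\}$ with the subspace topology. For a prime $p$ let $\mathbb{Z}[p^\infty]$ be the Prüfer $p$-group, that is, the subgroup of $\mathbb{Q}/\mathbb{Z}$ of elements of $p$-power order, and let $P=\bigoplus_{p\text{ prime}}\mathbb{Z}[p^\infty]^{(\mathbb{N})}$, where $B^{(\mathbb{N})}$ is the direct sum of countably infinitely many copies of $B$. Let $\mathcal{I}=\{G\in\mathcal{A}:\widetilde G\cong P\}$. Then: 1. $\mathcal{A}$ is a Polish space; 2. $\mathcal{I}$ is the set of all $G\in\mathcal{A}$ such that $\widetilde G$ is a divisible torsion group into which every finite abelian group embeds; 3. $\mathcal{I}$ is a $G_\delta$ subset of $\mathcal{A}$; 4. $\mathcal{I}$ is dense in $\mathcal{A}$; 5.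 $\mathcal{I}$ is comeager in $\mathcal{A}$. In particular there is a generic countably infinite abelian group: there is $A\in\mathcal{A}$ with $\widetilde A\cong P$ whose isomorphism class $\{G\in\mathcal{A}:\widetilde G\cong\widetilde A\}$ is comeager in $\mathcal{A}$. -/

import Mathlib

open scoped DirectSum

/-- The tables `A ∈ ℕ^(ℕ × ℕ)`, with `ℕ = {1, 2, 3, …}`, that are the multiplication table of a
group with underlying set `ℕ` and identity element `1`. -/
def groupTables : Set (ℕ+ × ℕ+ → ℕ+) :=
  {A | (∀ a b c, A (A (a, b), c) = A (a, A (b, c))) ∧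
       (∀ a, A (1, a) = a ∧ A (a, 1) = a) ∧
       (∀ a, ∃ b, A (b, a) = 1 ∧ A (a, b) = 1)}

/-- The space of multiplication tables of groups on `ℕ`, a subspace of the countable power
`ℕ^(ℕ × ℕ)` of the discrete space `ℕ`. -/
abbrev GroupTable : Type := ↥groupTables

/-- The group with underlying set `ℕ` whose multiplication table is `G`. (A type synonym of `ℕ+`,
so that the usual multiplication of `ℕ+` does not interfere.) -/
def GroupTable.Carrier (_G : GroupTable) : Type := ℕ+

noncomputable instance GroupTable.instGroupCarrier (G : GroupTable) : Group G.Carrier where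
  mul a b := G.1 (a, b)
  one := (1 : ℕ+)
  inv a := Classical.choose (G.2.2.2 a)
  mul_assoc a b c := G.2.1 a b c
  one_mul a := (G.2.2.1 a).1
  mul_one a := (G.2.2.1 a).2
  inv_mul_cancel a := (Classical.choose_spec (G.2.2.2 a)).1

/-- The set of tables of abelian groups. -/
def abelianTables : Set GroupTable :=
  {G | ∀ a b : G.Carrier, a * b = b * a}

/-- The space of multiplication tables of abelian groups on `ℕ`, with the subspace topology. -/
abbrev AbelianTable : Type := ↥abelianTables

/-- The group with underlying set `ℕ` whose multiplication table is `G`. -/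
abbrev AbelianTable.Carrier (G : AbelianTable) : Type := G.1.Carrier

/-- The isomorphism class of the group `H` in the space of abelian group tables. -/
def isoClass (H : Type*) [Group H] : Set AbelianTable :=
  {G | Nonempty (G.Carrier ≃* H)}

/-- The Prüfer group `ℤ[p^∞]`: the elements of `ℚ / ℤ` whose order is a power of `p`. -/
abbrev PruferGroup (p : Nat.Primes) : Type :=
  ↥(AddCommGroup.primaryComponent (AddCircle (1 : ℚ)) (p : ℕ))

/-- The direct sum, over all primes `p`, of countably infinitely many copies of `ℤ[p^∞]`. -/
abbrev PruferSum : Type := ⨁ (p : Nat.Primes) (_ : ℕ+), PruferGroup p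

/-- The tables of divisible groups. -/
def divisibleTables : Set AbelianTable :=
  {G | ∀ (g : G.Carrier) (k : ℕ), 0 < k → ∃ m : G.Carrier, m ^ k = g}

/-- The tables of torsion groups. -/
def torsionTables : Set AbelianTable :=
  {G | IsMulTorsion G.Carrier}

/-- The tables of groups into which every finite abelian group can be embedded. -/
def finiteUniversalTables : Set AbelianTable :=
  {G | ∀ (H : Type) [CommGroup H] [Finite H], ∃ f : H →* G.Carrier, Function.Injective f}

/-! A countable divisible torsion group is determined by the dimensions of its `p`-socles, so those
with all socles infinite form one isomorphism class, that of `P` (`nonempty_addEquiv_pruferSum`).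
The group `(ℚ/ℤ)^(ℕ)` is one of them, and characters into `ℚ/ℤ` make it a convenient model.
Containing every finite abelian group forces infinite socles, which gives the characterization.
Divisibility, torsion and infinite socles are countable intersections of open conditions on the
table, whence `G_δ`.

For density, a basic open set fixes finitely many entries of a table. Finitely many characters
separate the elements involved, giving a homomorphism to `(ℚ/ℤ)^(ℕ)` injective on them; it agrees
there with a bijection from `ℕ`, along which addition is transported back. A dense `G_δ` is
comeager. The space is Polish because adjoining the inverse function makes the group axioms closed.
-/

/-- An additive group is divisible if multiplication by every positive integer is surjective. -/
def IsDivisibleAddGroup (D : Type*) [AddCommGroup D] : Prop :=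
  ∀ n : ℕ, 0 < n → ∀ x : D, ∃ y : D, n • y = x

/-- The elements killed by `p` form an infinite set, for every prime `p`. -/
def HasInfiniteSocles (D : Type*) [AddCommGroup D] : Prop :=
  ∀ p : ℕ, p.Prime → {x : D | p • x = 0}.Infinite

/-! ### Divisible and torsion abelian groups -/

section Divisible

variable {D E : Type*} [AddCommGroup D] [AddCommGroup E]

theorem IsDivisibleAddGroup.baer (hD : IsDivisibleAddGroup D) : Module.Baer ℤ D := by
  let _ : DivisibleBy D ℕ :=
    divisibleByOfSMulRightSurj D ℕ fun {n} hn x => hD n (Nat.pos_of_ne_zero hn) x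
  let _ : DivisibleBy D ℤ := AddGroup.divisibleByIntOfDivisibleByNat D
  exact Module.Baer.of_divisible D

/-- The hypothesis makes `u ↦ d` well defined on the cyclic group generated by `u`, and injectivity
of `D` extends it. Infinite order is covered by `ZMod 0 = ℤ`. -/
theorem IsDivisibleAddGroup.exists_hom_apply_eq (hD : IsDivisibleAddGroup D) {u : E} {d : D}
    (h : addOrderOf u • d = 0) : ∃ f : E →+ D, f u = d := by
  let a : ZMod (addOrderOf u) →+ E := ZMod.lift _ ⟨zmultiplesHom E u, by simp⟩
  let b : ZMod (addOrderOf u) →+ D := ZMod.lift _ ⟨zmultiplesHom D d, by simpa using h⟩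
  have ha : Function.Injective a := (ZMod.lift_injective _).2 fun m hm => by
    rw [ZMod.intCast_zmod_eq_zero_iff_dvd]
    exact addOrderOf_dvd_iff_zsmul_eq_zero.2 (by simpa using hm)
  obtain ⟨f, hf⟩ := hD.baer.extension_property_addMonoidHom a ha b
  refine ⟨f, ?_⟩
  have ha1 : a 1 = u := by simpa using ZMod.lift_coe (addOrderOf u) ⟨zmultiplesHom E u, by simp⟩ 1
  have hb1 : b 1 = d := by
    simpa using ZMod.lift_coe (addOrderOf u) ⟨zmultiplesHom D d, by simpa using h⟩ 1
  rw [← ha1, ← hb1, ← hf]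
  rfl

theorem IsDivisibleAddGroup.directSum {ι : Type*} {M : ι → Type*} [∀ i, AddCommGroup (M i)]
    (h : ∀ i, IsDivisibleAddGroup (M i)) : IsDivisibleAddGroup (⨁ i, M i) := by
  classical
  intro n hn x
  induction x using DirectSum.induction_on with
  | zero => exact ⟨0, smul_zero n⟩
  | of i x =>
    obtain ⟨y, rfl⟩ := h i n hn x
    exact ⟨DirectSum.of M i y, (map_nsmul _ n y).symm⟩
  | add x y hx hy =>
    obtain ⟨a, rfl⟩ := hx
    obtain ⟨b, rfl⟩ := hy
    exact ⟨a + b, smul_add n a b⟩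

theorem IsAddTorsion.directSum {ι : Type*} {M : ι → Type*} [∀ i, AddCommGroup (M i)]
    (h : ∀ i, IsAddTorsion (M i)) : IsAddTorsion (⨁ i, M i) := by
  classical
  intro x
  induction x using DirectSum.induction_on with
  | zero => exact IsOfFinAddOrder.zero
  | of i x => exact AddMonoidHom.isOfFinAddOrder _ (h i x)
  | add x y hx hy => exact hx.add hy

/-- A homomorphism out of a torsion group is injective once it is injective on socles. -/
theorem AddMonoidHom.injective_of_torsion (hD : IsAddTorsion D) (f : D →+ E)
    (h : ∀ p : ℕ, p.Prime → ∀ x : D, p • x = 0 → f x = 0 → x = 0) : Function.Injective f := by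
  rw [injective_iff_map_eq_zero]
  intro x hx
  by_contra hne
  have h1 : addOrderOf x ≠ 1 := fun h => hne (AddMonoid.addOrderOf_eq_one_iff.1 h)
  obtain ⟨p, hp, m, hm⟩ := Nat.exists_prime_and_dvd h1
  have hpos := (hD x).addOrderOf_pos
  -- With `m = addOrderOf x / p`, the element `m • x` lies in the `p`-socle and in the kernel, so it
  -- vanishes, although `m` is less than the order.
  have hmx : m • x = 0 :=
    h p hp _ (by rw [← mul_nsmul', ← hm, addOrderOf_nsmul_eq_zero]) (by simp [hx])
  have hdvd := Nat.le_of_dvd (Nat.pos_of_ne_zero (by rintro rfl; simp_all))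
    (addOrderOf_dvd_iff_nsmul_eq_zero.2 hmx)
  have := hp.two_le
  nlinarith

/-- A homomorphism from a divisible group to a torsion group is surjective once its range contains
all socles. -/
theorem AddMonoidHom.surjective_of_torsion (hD : IsDivisibleAddGroup D) (hE : IsAddTorsion E)
    (f : D →+ E) (h : ∀ p : ℕ, p.Prime → ∀ x : E, p • x = 0 → ∃ y, f y = x) :
    Function.Surjective f := by
  suffices ∀ n : ℕ, 0 < n → ∀ x : E, n • x = 0 → ∃ y, f y = x from fun x =>
    this _ (hE x).addOrderOf_pos x (addOrderOf_nsmul_eq_zero x)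
  intro n
  induction n using Nat.recOnMul with
  | zero => simp
  | one => exact fun _ x hx => ⟨0, by simpa using hx.symm⟩
  | prime p hp => exact fun _ => h p hp
  | mul a b ha hb =>
    intro hab x hx
    have ha0 : 0 < a := Nat.pos_of_mul_pos_right hab
    have hb0 : 0 < b := Nat.pos_of_mul_pos_left hab
    -- Here `b • x` is killed by `a`, so it is `f y`; dividing `y` by `b` corrects `x` to an element
    -- killed by `b`.
    obtain ⟨y, hy⟩ := ha ha0 (b • x) (by rw [← mul_nsmul', hx])
    obtain ⟨z, rfl⟩ := hD b hb0 y
    obtain ⟨w, hw⟩ := hb hb0 (x - f z) (by rw [smul_sub, ← hy, map_nsmul, sub_self])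
    exact ⟨w + z, by rw [map_add, hw, sub_add_cancel]⟩

end Divisible

/-! ### The group `ℚ/ℤ` and its Prüfer subgroups -/

section RatCircle

theorem isDivisibleAddGroup_ratCircle : IsDivisibleAddGroup (AddCircle (1 : ℚ)) := fun n hn x =>
  ⟨DivisibleBy.div x (n : ℤ), by
    rw [← natCast_zsmul]; exact DivisibleBy.div_cancel x (by exact_mod_cast hn.ne')⟩

theorem isAddTorsion_ratCircle : IsAddTorsion (AddCircle (1 : ℚ)) := by
  intro x
  induction x using QuotientAddGroup.induction_on with
  | H q =>
    rw [← addOrderOf_pos_iff]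
    have := AddCircle.addOrderOf_coe_rat (p := (1 : ℚ)) (q := q)
    rw [Rat.cast_id, mul_one] at this
    exact this ▸ q.pos

instance : Countable (AddCircle (1 : ℚ)) :=
  (QuotientAddGroup.mk_surjective (s := AddSubgroup.zmultiples (1 : ℚ))).countable

theorem isAddTorsion_pruferGroup (p : Nat.Primes) : IsAddTorsion (PruferGroup p) := fun x => by
  rw [← addOrderOf_pos_iff, ← AddSubgroup.addOrderOf_coe, addOrderOf_pos_iff]
  exact isAddTorsion_ratCircle x

theorem isDivisibleAddGroup_pruferGroup (p : Nat.Primes) :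
    IsDivisibleAddGroup (PruferGroup p) := by
  intro n hn
  induction n using Nat.recOnMul with
  | zero => exact absurd hn (lt_irrefl 0)
  | one => exact fun x => ⟨x, one_nsmul x⟩
  | mul a b ha hb =>
    intro x
    obtain ⟨y, rfl⟩ := ha (Nat.pos_of_mul_pos_right hn) x
    obtain ⟨z, rfl⟩ := hb (Nat.pos_of_mul_pos_left hn) y
    exact ⟨z, mul_nsmul' z a b⟩
  | prime q hq =>
    rintro ⟨x, k, hk⟩
    by_cases hqp : q = p
    · subst hqp
      obtain ⟨y, rfl⟩ := isDivisibleAddGroup_ratCircle _ hq.pos x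
      exact ⟨⟨y, k + 1, by rw [pow_succ, mul_nsmul', hk]⟩, rfl⟩
    -- For `q ≠ p`, the Bézout coefficient inverts `q` modulo `p ^ k`, which kills `x`.
    · have hcop : Nat.Coprime q (p ^ k) := ((Nat.coprime_primes hq p.2).2 hqp).pow_right k
      refine ⟨q.gcdA (p ^ k) • ⟨x, k, hk⟩, Subtype.ext ?_⟩
      have hbez := Nat.gcd_eq_gcd_ab q (p ^ k)
      rw [hcop.gcd_eq_one] at hbez
      have hx : ((q * q.gcdA (p ^ k) + (p ^ k : ℕ) * q.gcdB (p ^ k) : ℤ)) • x = x := by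
        rw [← hbez]; simp
      rw [add_smul, mul_comm ((p ^ k : ℕ) : ℤ), mul_smul, mul_smul, natCast_zsmul, natCast_zsmul, hk,
        smul_zero, add_zero] at hx
      exact hx

/-- The class of `1 / p` in the Prüfer `p`-group. -/
def pruferGen (p : Nat.Primes) : PruferGroup p :=
  ⟨((1 / (p : ℕ) : ℚ) : AddCircle (1 : ℚ)), 1, by
    rw [pow_one, ← addOrderOf_dvd_iff_nsmul_eq_zero, AddCircle.addOrderOf_period_div p.2.pos]⟩

theorem addOrderOf_pruferGen (p : Nat.Primes) : addOrderOf (pruferGen p) = p := by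
  rw [← AddSubgroup.addOrderOf_coe]
  exact AddCircle.addOrderOf_period_div p.2.pos

theorem exists_nsmul_pruferGen {p : Nat.Primes} {x : PruferGroup p} (hx : (p : ℕ) • x = 0) :
    ∃ m : ℕ, m • pruferGen p = x := by
  obtain ⟨m, -, hm⟩ := (AddCircle.nsmul_eq_zero_iff p.2.pos).1 (congrArg Subtype.val hx)
  refine ⟨m, Subtype.ext ?_⟩
  rw [← hm]
  change m • ((1 / (p : ℕ) : ℚ) : AddCircle (1 : ℚ)) = _
  rw [← AddCircle.coe_nsmul, nsmul_eq_mul]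
  congr 1
  ring

theorem pruferGroup_eq_zero_of_prime_smul {p : ℕ} (hp : p.Prime) {q : Nat.Primes}
    (hpq : p ≠ q) {x : PruferGroup q} (hx : p • x = 0) : x = 0 := by
  obtain ⟨k, hk⟩ := x.2
  have h1 := addOrderOf_dvd_iff_nsmul_eq_zero.2 hx
  have h2 : addOrderOf x ∣ q ^ k := addOrderOf_dvd_iff_nsmul_eq_zero.2 (Subtype.ext hk)
  have hcop : Nat.Coprime p (q ^ k) := ((Nat.coprime_primes hp q.2).2 hpq).pow_right k
  exact AddMonoid.addOrderOf_eq_one_iff.1 (Nat.eq_one_of_dvd_coprimes hcop h1 h2)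

end RatCircle

theorem isDivisibleAddGroup_pruferSum : IsDivisibleAddGroup PruferSum :=
  .directSum fun p => .directSum fun _ => isDivisibleAddGroup_pruferGroup p

theorem isAddTorsion_pruferSum : IsAddTorsion PruferSum :=
  .directSum fun p => .directSum fun _ => isAddTorsion_pruferGroup p

/-! ### Classification by socles -/

section Classification

variable {D : Type*} [AddCommGroup D]

/-- In a countable group with infinite socles, the `p`-socle has a basis indexed by `ℕ+`. -/
theorem HasInfiniteSocles.exists_basis [Countable D] (hD : HasInfiniteSocles D)
    (p : Nat.Primes) : ∃ e : ℕ+ → D, (∀ i, (p : ℕ) • e i = 0) ∧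
      (∀ (s : Finset ℕ+) (c : ℕ+ → ℕ), ∑ i ∈ s, c i • e i = 0 → ∀ i ∈ s, (p : ℕ) ∣ c i) ∧
      ∀ x : D, (p : ℕ) • x = 0 → x ∈ AddSubgroup.closure (Set.range e) := by
  have : Fact (p : ℕ).Prime := ⟨p.2⟩
  let V := AddSubgroup.torsionBy D (p : ℕ)
  let _ : Module (ZMod p) V := AddSubgroup.torsionBy.zmodModule
  have hV : Infinite V := by
    refine Set.infinite_coe_iff.2 ((hD p p.2).mono fun x hx => ?_)
    exact AddSubgroup.torsionBy.nsmul_iff.2 hx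
  let b := Module.Basis.ofVectorSpace (ZMod p) V
  have hc : Countable (Module.Basis.ofVectorSpaceIndex (ZMod p) V) := inferInstance
  have hi : Infinite (Module.Basis.ofVectorSpaceIndex (ZMod p) V) := by
    by_contra hfin
    rw [not_infinite_iff_finite] at hfin
    have := Module.Finite.of_basis b
    have := Module.finite_of_finite (ZMod p) (M := V)
    exact not_finite V
  obtain ⟨g⟩ := nonempty_equiv_of_countable
    (α := Module.Basis.ofVectorSpaceIndex (ZMod p) V) (β := ℕ+)
  let b' := b.reindex g
  refine ⟨fun i => b' i, fun i => AddSubgroup.torsionBy.nsmul_iff.1 (b' i).2, ?_, ?_⟩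
  · intro s c h i hi
    rw [← ZMod.natCast_eq_zero_iff]
    refine linearIndependent_iff'.1 b'.linearIndependent s (fun i => (c i : ZMod p)) ?_ i hi
    refine Subtype.ext ?_
    simpa [Nat.cast_smul_eq_nsmul] using h
  · intro x hx
    have hmem := b'.mem_span ⟨x, AddSubgroup.torsionBy.nsmul_iff.2 hx⟩
    have key : ∀ y ∈ Submodule.span (ZMod p) (Set.range b'),
        (y : D) ∈ AddSubgroup.closure (Set.range fun i => (b' i : D)) := by
      intro y hy
      induction hy using Submodule.span_induction with
      | mem y hy =>
        obtain ⟨i, rfl⟩ := hy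
        exact AddSubgroup.subset_closure ⟨i, rfl⟩
      | zero => exact zero_mem _
      | add y z _ _ hy hz => exact add_mem hy hz
      | smul c y _ hy =>
        have : c • y = c.val • y := by
          rw [← Nat.cast_smul_eq_nsmul (ZMod p), ZMod.natCast_zmod_val]
        rw [this]
        exact nsmul_mem hy _
    exact key _ hmem

/-- Countable divisible torsion groups with infinite socles are direct sums of Prüfer groups. -/
theorem nonempty_addEquiv_pruferSum [Countable D] (hdiv : IsDivisibleAddGroup D)
    (htor : IsAddTorsion D) (hsoc : HasInfiniteSocles D) : Nonempty (D ≃+ PruferSum) := by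
  classical
  choose e he0 hind hspan using hsoc.exists_basis
  have hext : ∀ p i, ∃ f : PruferGroup p →+ D, f (pruferGen p) = e p i := fun p i =>
    hdiv.exists_hom_apply_eq (by rw [addOrderOf_pruferGen]; exact he0 p i)
  choose f hf using hext
  let F : PruferSum →+ D := DirectSum.toAddMonoid fun p => DirectSum.toAddMonoid fun i => f p i
  have hF : ∀ p i x, F (DirectSum.of (fun p : Nat.Primes => ⨁ _ : ℕ+, PruferGroup p) p
      (DirectSum.of (fun _ : ℕ+ => PruferGroup p) i x)) = f p i x := by
    intro p i x
    simp [F]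
  refine ⟨(AddEquiv.ofBijective F ⟨?_, ?_⟩).symm⟩
  · refine F.injective_of_torsion isAddTorsion_pruferSum fun p hp x hx hFx => ?_
    obtain ⟨p, rfl⟩ : ∃ q : Nat.Primes, (q : ℕ) = p := ⟨⟨p, hp⟩, rfl⟩
    have hcomp : ∀ q i, (p : ℕ) • x q i = 0 := fun q i =>
      congrArg (fun y : PruferSum => y q i) hx
    -- Only the `p`-component of `x` survives, since `ℤ[q^∞]` has no `p`-torsion for `q ≠ p`.
    have hx0 : x = DirectSum.of (fun p : Nat.Primes => ⨁ _ : ℕ+, PruferGroup p) p (x p) := by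
      refine DFinsupp.ext fun q => ?_
      by_cases hq : q = p
      · subst hq
        exact (DirectSum.of_eq_same
          (β := fun p : Nat.Primes => ⨁ _ : ℕ+, PruferGroup p) q (x q)).symm
      · rw [DirectSum.of_eq_of_ne _ _ _ hq]
        refine DFinsupp.ext fun i => ?_
        exact pruferGroup_eq_zero_of_prime_smul p.2
          (fun h => hq (Subtype.ext h.symm)) (hcomp q i)
    choose c hc using fun i => exists_nsmul_pruferGen (hcomp p i)
    have hsum : ∑ i ∈ DFinsupp.support (x p), c i • e p i = 0 := by
      calc ∑ i ∈ DFinsupp.support (x p), c i • e p i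
        _ = ∑ i ∈ DFinsupp.support (x p),
            F (DirectSum.of (fun p : Nat.Primes => ⨁ _ : ℕ+, PruferGroup p) p
              (DirectSum.of (fun _ : ℕ+ => PruferGroup p) i (x p i))) :=
          Finset.sum_congr rfl fun i _ => by rw [hF, ← hc i, map_nsmul, hf]
        _ = F x := by
          rw [← map_sum, ← map_sum, DirectSum.sum_support_of, ← hx0]
        _ = 0 := hFx
    suffices hxp : x p = 0 by rw [hx0, hxp, map_zero]
    refine DFinsupp.ext fun i => ?_
    by_contra hi
    refine hi ?_
    obtain ⟨m, hm⟩ := hind p _ c hsum i (DFinsupp.mem_support_iff.2 hi)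
    have hgen : (p : ℕ) • pruferGen p = 0 :=
      addOrderOf_dvd_iff_nsmul_eq_zero.1 (addOrderOf_pruferGen p).dvd
    rw [← hc i, hm, mul_comm, mul_nsmul', hgen, smul_zero]
    rfl
  · refine F.surjective_of_torsion isDivisibleAddGroup_pruferSum htor fun p hp x hx => ?_
    obtain ⟨p, rfl⟩ : ∃ q : Nat.Primes, (q : ℕ) = p := ⟨⟨p, hp⟩, rfl⟩
    refine (AddSubgroup.closure_le F.range).2 ?_ (hspan p x hx)
    rintro _ ⟨i, rfl⟩
    exact ⟨_, (hF p i (pruferGen p)).trans (hf p i)⟩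

end Classification

/-! ### The model `(ℚ/ℤ)^(ℕ)` -/

/-- The direct sum of countably many copies of `ℚ / ℤ`. -/
abbrev RatCircleSum : Type := ⨁ _ : ℕ, AddCircle (1 : ℚ)

instance : Countable RatCircleSum := by
  classical
  exact (finsuppEquivDFinsupp (ι := ℕ) (M := AddCircle (1 : ℚ))).symm.injective.countable

/-- Finite subsets of abelian groups are separated by homomorphisms to `RatCircleSum`. -/
theorem exists_hom_ratCircleSum_injOn {A : Type*} [AddCommGroup A] {s : Set A} (hs : s.Finite) :
    ∃ f : A →+ RatCircleSum, Set.InjOn f s := by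
  classical
  have hchar : ∀ a : A, ∃ c : A →+ AddCircle (1 : ℚ), a ≠ 0 → c a ≠ 0 := fun a => by
    by_cases ha : a = 0
    · exact ⟨0, fun h => absurd ha h⟩
    · obtain ⟨c, hc⟩ := CharacterModule.exists_character_apply_ne_zero_of_ne_zero ha
      exact ⟨c, fun _ => hc⟩
  choose c hc using hchar
  -- `r` lists the differences of elements of `s`; coordinate `j` of `f` is a character detecting
  -- the `j`-th difference when it is nonzero.
  obtain ⟨n, r, hr⟩ := (hs.sub hs).fin_embedding
  let f : A →+ RatCircleSum := ∑ j : Fin n, (DirectSum.of _ (j : ℕ)).comp (c (r j))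
  have hf : ∀ (a : A) (j : Fin n), f a (j : ℕ) = c (r j) a := by
    intro a j
    simp [f, DirectSum.sum_apply, DirectSum.of_apply, Fin.val_inj]
  refine ⟨f, fun a ha b hb hab => ?_⟩
  by_contra hne
  obtain ⟨j, hj⟩ : a - b ∈ Set.range r := hr ▸ Set.sub_mem_sub ha hb
  refine hc (a - b) (sub_ne_zero.2 hne) ?_
  rw [← hj, ← hf, hj, map_sub, hab, sub_self]
  rfl

theorem isDivisibleAddGroup_ratCircleSum : IsDivisibleAddGroup RatCircleSum :=
  .directSum fun _ => isDivisibleAddGroup_ratCircle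

theorem isAddTorsion_ratCircleSum : IsAddTorsion RatCircleSum :=
  .directSum fun _ => isAddTorsion_ratCircle

theorem hasInfiniteSocles_ratCircleSum : HasInfiniteSocles RatCircleSum := by
  classical
  intro p hp
  let u : AddCircle (1 : ℚ) := ((1 / p : ℚ) : AddCircle (1 : ℚ))
  have hu : addOrderOf u = p := AddCircle.addOrderOf_period_div hp.pos
  have hu0 : u ≠ 0 := fun h => hp.one_lt.ne' (by rw [← hu, h, addOrderOf_zero])
  refine Set.infinite_of_injective_forall_mem (f := fun i : ℕ =>
    (DirectSum.of (fun _ => AddCircle (1 : ℚ)) i u : RatCircleSum)) (fun i j hij => ?_) fun i => ?_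
  · by_contra hne
    have := congrArg (fun x : RatCircleSum => x i) hij
    simp only [DirectSum.of_eq_same, DirectSum.of_eq_of_ne _ _ _ hne] at this
    exact hu0 this
  · have : p • u = 0 := by rw [← hu]; exact addOrderOf_nsmul_eq_zero u
    simp only [Set.mem_ofPred_eq, ← map_nsmul, this, map_zero]

instance : Infinite RatCircleSum :=
  Set.infinite_univ_iff.1 ((hasInfiniteSocles_ratCircleSum 2 Nat.prime_two).mono
    (Set.subset_univ _))

theorem nonempty_ratCircleSum_addEquiv_pruferSum : Nonempty (RatCircleSum ≃+ PruferSum) :=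
  nonempty_addEquiv_pruferSum isDivisibleAddGroup_ratCircleSum isAddTorsion_ratCircleSum
    hasInfiniteSocles_ratCircleSum

/-! ### Transported tables and the isomorphism class of `P` -/

namespace AbelianTable

noncomputable instance commGroup (G : AbelianTable) : CommGroup G.Carrier :=
  { G.1.instGroupCarrier with mul_comm := G.2 }

/-- The table obtained by transporting the addition of an abelian group to `ℕ+`. -/
def ofEquiv {T : Type*} [AddCommGroup T] (e : ℕ+ ≃ T) (he : e 1 = 0) : AbelianTable :=
  ⟨⟨fun x => e.symm (e x.1 + e x.2), by
    refine ⟨fun a b c => ?_, fun a => ?_, fun a => ⟨e.symm (-e a), ?_⟩⟩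
    · simp [add_assoc]
    · simp [he]
    · simp [← he]⟩, fun a b => congrArg e.symm (add_comm (e a) (e b))⟩

/-- The group of the transported table is the group it was transported from. -/
def ofEquivMulEquiv {T : Type*} [AddCommGroup T] (e : ℕ+ ≃ T) (he : e 1 = 0) :
    (ofEquiv e he).Carrier ≃* Multiplicative T where
  toEquiv := e.trans Multiplicative.ofAdd
  map_mul' a b := congrArg Multiplicative.ofAdd (e.apply_symm_apply (e a + e b))

/-- The tables of groups all of whose socles are infinite. -/
def infiniteSocleTables : Set AbelianTable :=
  {G | ∀ p : ℕ, p.Prime → {x : G.Carrier | x ^ p = 1}.Infinite}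

theorem countable_carrier (G : AbelianTable) : Countable G.Carrier := inferInstanceAs (Countable ℕ+)

theorem isoClass_ratCircleSum :
    isoClass (Multiplicative PruferSum) = isoClass (Multiplicative RatCircleSum) := by
  obtain ⟨e⟩ := nonempty_ratCircleSum_addEquiv_pruferSum
  exact Set.ext fun G => ⟨fun ⟨f⟩ => ⟨f.trans e.symm.toMultiplicative⟩,
    fun ⟨f⟩ => ⟨f.trans e.toMultiplicative⟩⟩

theorem finiteUniversalTables_subset : finiteUniversalTables ⊆ infiniteSocleTables := by
  intro G hG p hp hfin
  have : Fact p.Prime := ⟨hp⟩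
  -- If the socle had `k` elements, it could not contain `(ℤ/p)^k`, as `k < p ^ k`.
  let k := {x : G.Carrier | x ^ p = 1}.ncard
  obtain ⟨f, hf⟩ := hG (Multiplicative (Fin k → ZMod p))
  have hmem : ∀ x, f x ∈ {x : G.Carrier | x ^ p = 1} := by
    intro x
    have hx : x ^ p = 1 := by
      refine Multiplicative.toAdd.injective (funext fun i => ?_)
      simp
    rw [Set.mem_ofPred_eq, ← map_pow, hx, map_one]
  have hle : Nat.card (Multiplicative (Fin k → ZMod p)) ≤ k := by
    have := hfin.to_subtype
    exact Nat.card_le_card_of_injective (fun x => (⟨f x, hmem x⟩ : {x : G.Carrier | x ^ p = 1}))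
      fun x y hxy => hf (congrArg Subtype.val hxy)
  have hcard : Nat.card (Multiplicative (Fin k → ZMod p)) = p ^ k := by
    simp [Nat.card_eq_fintype_card]
  exact absurd (hcard ▸ hle) (not_le.2 (Nat.lt_pow_self hp.one_lt))

theorem isoClass_subset : isoClass (Multiplicative PruferSum) ⊆
    divisibleTables ∩ torsionTables ∩ finiteUniversalTables := by
  rw [isoClass_ratCircleSum]
  rintro G ⟨e⟩
  refine ⟨⟨fun g k hk => ?_, fun g => ?_⟩, ?_⟩
  · obtain ⟨y, hy⟩ := isDivisibleAddGroup_ratCircleSum k hk (e g).toAdd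
    refine ⟨e.symm (Multiplicative.ofAdd y), ?_⟩
    rw [← map_pow, ← ofAdd_nsmul, hy, ofAdd_toAdd, e.symm_apply_apply]
  · rw [← e.injective.isOfFinOrder_iff (f := e.toMonoidHom)]
    exact isOfFinOrder_ofAdd_iff (x := (e g).toAdd).2 (isAddTorsion_ratCircleSum (e g).toAdd)
  · intro H _ _
    obtain ⟨f, hf⟩ := exists_hom_ratCircleSum_injOn (Set.toFinite (Set.univ : Set (Additive H)))
    refine ⟨e.symm.toMonoidHom.comp (AddMonoidHom.toMultiplicativeRight f), ?_⟩
    exact e.symm.injective.comp (Set.injOn_univ.1 hf)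

theorem subset_isoClass : divisibleTables ∩ torsionTables ∩ infiniteSocleTables ⊆
    isoClass (Multiplicative PruferSum) := by
  rintro G ⟨⟨hdiv, htor⟩, hsoc⟩
  have := G.countable_carrier
  have : Countable (Additive G.Carrier) := this
  obtain ⟨e⟩ := nonempty_addEquiv_pruferSum (D := Additive G.Carrier)
    (fun n hn x => hdiv x.toMul n hn)
    (fun x => isOfFinAddOrder_ofMul_iff (x := x.toMul).2 (htor x.toMul)) hsoc
  exact ⟨(MulEquiv.toAdditiveLeft.symm e : G.Carrier ≃* Multiplicative PruferSum)⟩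

theorem isoClass_eq_finiteUniversal : isoClass (Multiplicative PruferSum) =
    divisibleTables ∩ torsionTables ∩ finiteUniversalTables :=
  isoClass_subset.antisymm
    ((Set.inter_subset_inter_right _ finiteUniversalTables_subset).trans subset_isoClass)

/-- Infinite socles replace finite universality because they are visibly a countable intersection of
open conditions. -/
theorem isoClass_eq_infiniteSocle : isoClass (Multiplicative PruferSum) =
    divisibleTables ∩ torsionTables ∩ infiniteSocleTables :=
  (isoClass_subset.trans
    (Set.inter_subset_inter_right _ finiteUniversalTables_subset)).antisymm subset_isoClass

end AbelianTable

/-! ### Topology of the space of tables -/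

section Topology

/-- Since `g` is locally constant, evaluation at `g x` is locally evaluation at a fixed point. -/
theorem Continuous.eval_of_discrete {X α β : Type*} [TopologicalSpace X] [TopologicalSpace α]
    [DiscreteTopology α] [TopologicalSpace β] {f : X → α → β} {g : X → α} (hf : Continuous f)
    (hg : Continuous g) : Continuous fun x => f x (g x) := by
  rw [continuous_iff_continuousAt]
  intro x
  have hev : ∀ᶠ y in nhds x, g y = g x :=
    hg.continuousAt.eventually (p := fun a => a = g x) (by simp)
  refine ((continuous_apply (g x)).comp hf).continuousAt.congr ?_
  filter_upwards [hev] with y hy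
  simp [hy]

namespace AbelianTable

theorem continuous_table : Continuous fun G : AbelianTable => G.1.1 :=
  continuous_subtype_val.comp continuous_subtype_val

theorem continuous_mul {a b : AbelianTable → ℕ+} (ha : Continuous a) (hb : Continuous b) :
    Continuous fun G : AbelianTable => G.1.1 (a G, b G) :=
  continuous_table.eval_of_discrete (ha.prodMk hb)

/-- The `k`-th power of `m` in the group with table `G`. -/
noncomputable def powFun (m : ℕ+) (k : ℕ) (G : AbelianTable) : ℕ+ :=
  let x : G.Carrier := m
  x ^ k

theorem continuous_powFun (m : ℕ+) (k : ℕ) : Continuous (powFun m k) := by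
  induction k with
  | zero =>
    exact (continuous_const (y := (1 : ℕ+))).congr fun G =>
      (pow_zero (M := G.Carrier) m).symm
  | succ k ih =>
    exact (continuous_mul ih (continuous_const (y := m))).congr fun G =>
      (pow_succ (M := G.Carrier) m k).symm

theorem isOpen_powFun_eq (m : ℕ+) (k : ℕ) (g : ℕ+) : IsOpen (powFun m k ⁻¹' {g}) :=
  (isOpen_discrete {g}).preimage (continuous_powFun m k)

theorem isGδ_divisibleTables : IsGδ divisibleTables := by
  have : divisibleTables = ⋂ (g : ℕ+) (k : ℕ) (_ : 0 < k), ⋃ m : ℕ+, powFun m k ⁻¹' {g} := by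
    ext G
    simp only [Set.mem_iInter, Set.mem_iUnion]
    rfl
  rw [this]
  exact .iInter fun g => .iInter fun k => .iInter fun _ =>
    (isOpen_iUnion fun m => isOpen_powFun_eq m k g).isGδ

theorem isGδ_torsionTables : IsGδ torsionTables := by
  have : torsionTables = ⋂ (g : ℕ+), ⋃ (k : ℕ) (_ : 0 < k), powFun g k ⁻¹' {1} := by
    ext G
    simp only [Set.mem_iInter, Set.mem_iUnion, exists_prop]
    exact forall_congr' fun g => isOfFinOrder_iff_pow_eq_one (G := G.Carrier)
  rw [this]
  exact .iInter fun g => (isOpen_iUnion fun k => isOpen_iUnion fun _ =>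
    isOpen_powFun_eq g k 1).isGδ

theorem isGδ_infiniteSocleTables : IsGδ infiniteSocleTables := by
  have : infiniteSocleTables = ⋂ (p : ℕ) (_ : p.Prime) (n : ℕ+), ⋃ (m : ℕ+) (_ : n < m),
      powFun m p ⁻¹' {1} := by
    ext G
    simp only [Set.mem_iInter, Set.mem_iUnion, exists_prop]
    refine forall₂_congr fun p _ => ?_
    refine (Set.infinite_iff_exists_gt (α := ℕ+)).trans (forall_congr' fun n => ?_)
    exact exists_congr fun m => and_comm
  rw [this]
  exact .iInter fun p => .iInter fun _ => .iInter fun n =>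
    (isOpen_iUnion fun m => isOpen_iUnion fun _ => isOpen_powFun_eq m p 1).isGδ

theorem isGδ_isoClass : IsGδ (isoClass (Multiplicative PruferSum)) := by
  rw [isoClass_eq_infiniteSocle]
  exact (isGδ_divisibleTables.inter isGδ_torsionTables).inter isGδ_infiniteSocleTables

/-- A map that is injective on a finite set agrees there with a bijection. -/
theorem _root_.Set.InjOn.exists_equiv_eqOn {α β : Type*} [Countable α] [Infinite α] [Countable β]
    [Infinite β] {s : Set α} (hs : s.Finite) {f : α → β} (hf : s.InjOn f) :
    ∃ e : α ≃ β, s.EqOn e f := by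
  have := hs.to_subtype
  let g : s ↪ β := ⟨fun x => f x, fun x y h => Subtype.ext (hf x.2 y.2 h)⟩
  have h1 : Infinite (sᶜ : Set α) := hs.infinite_compl.to_subtype
  have h2 : Infinite ((Set.range g)ᶜ : Set β) := (Set.finite_range g).infinite_compl.to_subtype
  obtain ⟨e, he⟩ := Cardinal.extend_function g nonempty_equiv_of_countable
  exact ⟨e, fun x hx => he ⟨x, hx⟩⟩

theorem dense_isoClass : Dense (isoClass (Multiplicative PruferSum)) := by
  classical
  rw [isoClass_ratCircleSum, dense_iff_inter_open]
  rintro U hU ⟨G, hG⟩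
  obtain ⟨U', hU', rfl⟩ := isOpen_induced_iff.1 hU
  obtain ⟨V, hV, rfl⟩ := isOpen_induced_iff.1 hU'
  obtain ⟨I, u, hu, hsub⟩ := isOpen_pi_iff.1 hV _ hG
  -- Including `1` makes the bijection send the identity to `0`.
  let s : Set ℕ+ := {1} ∪ ⋃ i ∈ I, {i.1, i.2, G.1.1 i}
  have hs : s.Finite := (Set.finite_singleton _).union
    (I.finite_toSet.biUnion fun i _ => Set.toFinite _)
  obtain ⟨f, hf⟩ := exists_hom_ratCircleSum_injOn (A := Additive G.Carrier) (s := s) hs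
  obtain ⟨e, he⟩ := Set.InjOn.exists_equiv_eqOn (α := ℕ+) (β := RatCircleSum) hs hf
  have he1 : e 1 = 0 := (he (Or.inl rfl)).trans (map_zero f)
  refine ⟨ofEquiv e he1, hsub fun i hi => ?_, ⟨ofEquivMulEquiv e he1⟩⟩
  have hmem : ∀ x ∈ ({i.1, i.2, G.1.1 i} : Set ℕ+), x ∈ s := fun x hx =>
    Or.inr (Set.mem_biUnion hi hx)
  have heq : e.symm (e i.1 + e i.2) = G.1.1 i := by
    rw [Equiv.symm_apply_eq, he (hmem i.1 (by simp)), he (hmem i.2 (by simp)),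
      he (hmem (G.1.1 i) (by simp))]
    exact (map_add f _ _).symm
  change e.symm (e i.1 + e i.2) ∈ u i
  rw [heq]
  exact (hu i hi).2

/-- The inverse function of the group with table `G`. -/
noncomputable def invFun (G : AbelianTable) (a : ℕ+) : ℕ+ := ((a : G.Carrier)⁻¹ : G.Carrier)

theorem continuous_invFun : Continuous invFun := by
  refine continuous_pi fun a => continuous_discrete_rng.2 fun b => ?_
  have : (fun G => invFun G a) ⁻¹' {b} = {G : AbelianTable | G.1.1 (a, b) = 1} := by
    ext G
    exact inv_eq_iff_mul_eq_one (G := G.Carrier) (a := a) (b := b)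
  rw [this]
  exact (isOpen_discrete {1}).preimage ((continuous_apply (a, b)).comp continuous_table)

/-- Existence of inverses is not visibly closed in the table alone; with the inverse function as a
second coordinate, it becomes an equation between continuous maps. -/
theorem isClosedEmbedding_table_invFun :
    Topology.IsClosedEmbedding fun G : AbelianTable => (G.1.1, invFun G) := by
  have hcont : Continuous fun G : AbelianTable => (G.1.1, invFun G) :=
    continuous_table.prodMk continuous_invFun
  refine ⟨.of_comp hcont continuous_fst
    (Topology.IsEmbedding.subtypeVal.comp Topology.IsEmbedding.subtypeVal), ?_⟩
  have hrange : Set.range (fun G : AbelianTable => (G.1.1, invFun G)) =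
      {x : (ℕ+ × ℕ+ → ℕ+) × (ℕ+ → ℕ+) |
        (∀ a b c, x.1 (x.1 (a, b), c) = x.1 (a, x.1 (b, c))) ∧
        (∀ a, x.1 (1, a) = a) ∧ (∀ a b, x.1 (a, b) = x.1 (b, a)) ∧
        ∀ a, x.1 (a, x.2 a) = 1} := by
    ext ⟨A, j⟩
    constructor
    · rintro ⟨G, hG⟩
      obtain ⟨rfl, rfl⟩ := Prod.mk.inj hG
      exact ⟨G.1.2.1, fun a => (G.1.2.2.1 a).1, G.2, fun a => mul_inv_cancel (G := G.Carrier) a⟩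
    · rintro ⟨hassoc, hone, hcomm, hinv⟩
      let G : AbelianTable := ⟨⟨A, hassoc, fun a => ⟨hone a, (hcomm a 1).trans (hone a)⟩,
        fun a => ⟨j a, (hcomm _ _).trans (hinv a), hinv a⟩⟩, hcomm⟩
      exact ⟨G, Prod.ext rfl (funext fun a =>
        inv_eq_of_mul_eq_one_right (G := G.Carrier) (a := a) (b := j a) (hinv a))⟩
  have happly : ∀ a : ℕ+ × ℕ+, Continuous fun x : (ℕ+ × ℕ+ → ℕ+) × (ℕ+ → ℕ+) => x.1 a := fun a =>
    (continuous_apply a).comp continuous_fst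
  rw [hrange]
  simp only [Set.ofPred_and, Set.ofPred_forall]
  refine .inter ?_ (.inter ?_ (.inter ?_ ?_))
  · exact isClosed_iInter fun a => isClosed_iInter fun b => isClosed_iInter fun c => isClosed_eq
      (continuous_fst.eval_of_discrete ((happly (a, b)).prodMk continuous_const))
      (continuous_fst.eval_of_discrete (continuous_const.prodMk (happly (b, c))))
  · exact isClosed_iInter fun a => isClosed_eq (happly _) continuous_const
  · exact isClosed_iInter fun a => isClosed_iInter fun b => isClosed_eq (happly _) (happly _)
  · exact isClosed_iInter fun a => isClosed_eq (continuous_fst.eval_of_discrete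
      (continuous_const.prodMk ((continuous_apply a).comp continuous_snd))) continuous_const

end AbelianTable

end Topology

theorem corollary3p15 :
    PolishSpace AbelianTable ∧
    isoClass (Multiplicative PruferSum) =
      divisibleTables ∩ torsionTables ∩ finiteUniversalTables ∧
    IsGδ (isoClass (Multiplicative PruferSum)) ∧
    Dense (isoClass (Multiplicative PruferSum)) ∧
    isoClass (Multiplicative PruferSum) ∈ residual AbelianTable ∧
    ∃ A : AbelianTable, Nonempty (A.Carrier ≃* Multiplicative PruferSum) ∧
      isoClass A.Carrier ∈ residual AbelianTable := by
  have hres : isoClass (Multiplicative PruferSum) ∈ residual AbelianTable :=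
    residual_of_dense_Gδ AbelianTable.isGδ_isoClass AbelianTable.dense_isoClass
  refine ⟨AbelianTable.isClosedEmbedding_table_invFun.polishSpace,
    AbelianTable.isoClass_eq_finiteUniversal, AbelianTable.isGδ_isoClass,
    AbelianTable.dense_isoClass, hres, ?_⟩
  obtain ⟨e, he⟩ := Set.InjOn.exists_equiv_eqOn (α := ℕ+) (β := RatCircleSum)
    (f := fun _ => 0) (Set.finite_singleton 1) (Set.injOn_singleton _ _)
  obtain ⟨g⟩ := nonempty_ratCircleSum_addEquiv_pruferSum
  let A := AbelianTable.ofEquiv e (he rfl)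
  have i : A.Carrier ≃* Multiplicative PruferSum :=
    (AbelianTable.ofEquivMulEquiv e (he rfl)).trans g.toMultiplicative
  refine ⟨A, ⟨i⟩, Filter.mem_of_superset hres ?_⟩
  rintro G ⟨f⟩
  exact ⟨f.trans i.symm⟩
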